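/- Let $K$ be a field with $\operatorname{char} K \neq 2$, let $D \in K^\times$, and let $G_K = \operatorname{Gal}(K^{\mathrm{sep}}/K)$. For a commutative ring $R$ and $d\in R$ write $R[\sqrt d] = R[X]/(X^2-d)$ (for $R=K$, $d$ is allowed to be a square). Let $M$ be the group $\mathbb{Z}/4$ on which $g \in G_K$ acts as the identity if $g$ fixes the two $K$-algebra maps $K[\sqrt D]\to K^{\mathrm{sep}}$, and as $-1$ if $g$ swaps them. Let $H^1(K,M)$ be the group of continuous crossed homomorphisms $\sigma : G_K \to M$ modulo the maps $g \mapsto gx - x$ $(x\in M)$, and let $N : K[\sqrt{-D}] \to K$ be the norm, $N(a+b\sqrt{-D}) = a^2 + Db^2$. Then there is a group isomorphism $$H^1(K,M) \;\cong\; \{(\alpha,c) \in K[\sqrt{-D}]^\times \times K^\times : N(\alpha) = c^4\} \,/\, \{(\beta^4, N(\beta)) : \beta \in K[\sqrt{-D}]^\times\}$$ with the following property. Whenever the class of a cocycle $\sigma$ corresponds to the class of a pair $(a + b\sqrt{-D}, c)$ with $a,b,c\in K$ and $b \neq 0$, the quartic algebra corresponding to $\sigma$ is $$L = K\left[\sqrt{2a+2c^2}\right]\left[\sqrt{2c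 + \sqrt{2a+2c^2}}\right].$$ That is, $L$ is étale over $K$, and its $K$-algebra maps to $K^{\mathrm{sep}}$ can be labelled bijectively as $(\iota_x)_{x \in M}$ such that $g \circ \iota_x = \iota_{gx + \sigma(g)}$ for all $g \in G_K$ and $x\in M$, and such that $\iota_x$ and $\iota_y$ agree on the subalgebra $K[\sqrt{2a+2c^2}]$ if and only if $2x = 2y$ (so the labelling respects the $D_4$-structure that $L$ has as a quadratic extension of a quadratic extension). Moreover, if $K$ has more than $5$ elements, then every class in the quotient group on the right is represented by a pair $(a + b\sqrt{-D}, c)$ with $b \neq 0$. -/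

import Mathlib

/-! ### First continuous cohomology of a discrete Galois module -/

/-- The absolute Galois group `G_K = Gal(K^sep / K)`, with its Krull topology. -/
abbrev AbsGal (K : Type*) [Field K] : Type _ :=
  SeparableClosure K ≃ₐ[K] SeparableClosure K

/-- Continuous 1-cocycles `σ : G → M` (crossed homomorphisms). The module `M` is discrete, so
continuity is local constancy. -/
def Z1 (G M : Type*) [Group G] [TopologicalSpace G] [AddCommGroup M] [DistribMulAction G M] :
    AddSubgroup (G → M) where
  carrier := {σ | IsLocallyConstant σ ∧ ∀ g h : G, σ (g * h) = σ g + g • σ h}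
  zero_mem' := ⟨IsLocallyConstant.const 0, fun g h => by simp⟩
  add_mem' := by
    rintro σ τ ⟨hσ, hσ'⟩ ⟨hτ, hτ'⟩
    refine ⟨hσ.add hτ, fun g h => ?_⟩
    simp only [Pi.add_apply, hσ', hτ', smul_add]
    abel
  neg_mem' := by
    rintro σ ⟨hσ, hσ'⟩
    refine ⟨hσ.neg, fun g h => ?_⟩
    simp only [Pi.neg_apply, hσ', smul_neg]
    abel

/-- 1-coboundaries `g ↦ g x - x`. -/
def B1 (G M : Type*) [Group G] [AddCommGroup M] [DistribMulAction G M] :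
    AddSubgroup (G → M) where
  carrier := {σ | ∃ x : M, ∀ g : G, σ g = g • x - x}
  zero_mem' := ⟨0, fun g => by simp⟩
  add_mem' := by
    rintro σ τ ⟨x, hx⟩ ⟨y, hy⟩
    refine ⟨x + y, fun g => ?_⟩
    simp only [Pi.add_apply, hx, hy, smul_add]
    abel
  neg_mem' := by
    rintro σ ⟨x, hx⟩
    refine ⟨-x, fun g => ?_⟩
    simp only [Pi.neg_apply, hx, smul_neg]
    abel

/-- `H¹(G, M) = Z¹(G, M) / B¹(G, M)`. -/
abbrev H1 (G M : Type*) [Group G] [TopologicalSpace G] [AddCommGroup M] [DistribMulAction G M] :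
    Type _ :=
  Z1 G M ⧸ (B1 G M).addSubgroupOf (Z1 G M)

/-! ### Quadratic algebras and the associated cyclic module of order four -/

/-- The quadratic algebra `R[√d] = R[X] / (X² - d)`; the element `⟨x, y⟩` is `x + y √d`. -/
abbrev SqrtAlg {R : Type*} [CommRing R] (d : R) : Type _ := QuadraticAlgebra R d 0

/-- The coordinates of a `K`-algebra `L`: its `K`-algebra maps to `K^sep`. -/
abbrev Coord (K L : Type*) [Field K] [CommRing L] [Algebra K L] : Type _ :=
  L →ₐ[K] SeparableClosure K

/-- `g` fixes each of the coordinates of `K[√D]`; otherwise it swaps the two of them. -/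
def FixesCoords {K : Type*} [Field K] (D : K) (g : AbsGal K) : Prop :=
  ∀ (ι : Coord K (SqrtAlg D)) (z : SqrtAlg D), g (ι z) = ι z

/-- The underlying group `ℤ/4` of the cyclic Galois module of order four attached to `K[√D]`. -/
def CyclicFour {K : Type*} [Field K] (_D : K) : Type := ZMod 4

instance {K : Type*} [Field K] (D : K) : AddCommGroup (CyclicFour D) :=
  inferInstanceAs (AddCommGroup (ZMod 4))

open Classical in
/-- The sign by which `g` acts: `1` if `g` fixes the two coordinates of `K[√D]`, and `-1` if it
swaps them. -/
noncomputable def quadSign {K : Type*} [Field K] (D : K) (g : AbsGal K) : ℤ :=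
  if FixesCoords D g then 1 else -1

theorem fixesCoords_iff {K : Type*} [Field K] (D : K) (g : AbsGal K) :
    FixesCoords D g ↔
      ∀ ι : Coord K (SqrtAlg D), g (ι QuadraticAlgebra.omega) = ι QuadraticAlgebra.omega := by
  refine ⟨fun h ι => h ι _, fun h ι z => ?_⟩
  have := QuadraticAlgebra.algHom_ext (f := (g : SeparableClosure K →ₐ[K] _).comp ι) (g := ι)
    (by simpa using h ι)
  exact DFunLike.congr_fun this z

theorem coord_omega_sq {K : Type*} [Field K] (D : K) (ι : Coord K (SqrtAlg D)) :
    ι QuadraticAlgebra.omega ^ 2 = algebraMap K (SeparableClosure K) D := by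
  rw [← map_pow, ← AlgHom.commutes ι]
  congr 1
  ext <;> simp [pow_two]

theorem quadSign_mul {K : Type*} [Field K] (D : K) (g h : AbsGal K) :
    quadSign D (g * h) = quadSign D g * quadSign D h := by
  have key : ∀ (k : AbsGal K) (ι ι' : Coord K (SqrtAlg D)),
      k (ι QuadraticAlgebra.omega) = ι QuadraticAlgebra.omega →
      k (ι' QuadraticAlgebra.omega) = ι' QuadraticAlgebra.omega := by
    intro k ι ι' hk
    rcases sq_eq_sq_iff_eq_or_eq_neg.mp
      ((coord_omega_sq D ι').trans (coord_omega_sq D ι).symm) with e | e <;> simp [e, hk]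
  have neg : ∀ (k : AbsGal K) (ι : Coord K (SqrtAlg D)), ¬ FixesCoords D k →
      k (ι QuadraticAlgebra.omega) = - ι QuadraticAlgebra.omega := by
    intro k ι hk
    have e : (k (ι QuadraticAlgebra.omega)) ^ 2 = (ι QuadraticAlgebra.omega) ^ 2 := by
      rw [← map_pow, coord_omega_sq, AlgEquiv.commutes]
    rcases sq_eq_sq_iff_eq_or_eq_neg.mp e with e | e
    · exact absurd ((fixesCoords_iff D k).2 fun ι' => key k ι ι' e) hk
    · exact e
  have e : FixesCoords D (g * h) ↔ (FixesCoords D g ↔ FixesCoords D h) := by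
    by_cases hg : FixesCoords D g <;> by_cases hh : FixesCoords D h
    · simp only [hg, hh, iff_self, iff_true]
      intro ι z
      rw [AlgEquiv.mul_apply, hh, hg]
    · simp only [hg, hh, iff_false, not_true]
      intro H
      refine hh fun ι z => g.injective ?_
      rw [hg]
      exact H ι z
    · simp only [hg, hh, iff_true]
      refine iff_of_false (fun H => hg fun ι z => ?_) not_false
      have := H ι z
      rwa [AlgEquiv.mul_apply, hh] at this
    · simp only [hg, hh, iff_true]
      refine (fixesCoords_iff D _).2 fun ι => ?_
      rw [AlgEquiv.mul_apply, neg h ι hh, map_neg, neg g ι hg, neg_neg]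
  by_cases hg : FixesCoords D g <;> by_cases hh : FixesCoords D h <;> simp [quadSign, e, hg, hh]

/-- `G_K` acts on `ℤ/4` by automorphisms, permuting the two generators `1, -1` in the way it
permutes the two coordinates of `K[√D]`. -/
noncomputable instance {K : Type*} [Field K] (D : K) :
    DistribMulAction (AbsGal K) (CyclicFour D) where
  smul g x := quadSign D g • x
  one_smul x := by
    change quadSign D 1 • x = x
    have : FixesCoords D (1 : AbsGal K) := fun ι z => rfl
    simp [quadSign, this]
  mul_smul g h x := by
    change quadSign D (g * h) • x = quadSign D g • quadSign D h • x
    rw [quadSign_mul, mul_smul]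
  smul_zero g := smul_zero (quadSign D g)
  smul_add g := smul_add (quadSign D g)

/-! ### The group of Kummer data -/

/-- Pairs `(α, c)` in `K[√(-D)]ˣ × Kˣ` with `N(α) = c⁴`. -/
def kummerData {K : Type*} [Field K] (D : K) : Subgroup ((SqrtAlg (-D))ˣ × Kˣ) where
  carrier := {p | Units.map QuadraticAlgebra.norm p.1 = p.2 ^ 4}
  one_mem' := by simp
  mul_mem' := by
    intro p q hp hq
    simp only [Set.mem_ofPred_eq, Prod.fst_mul, Prod.snd_mul, map_mul, mul_pow] at *
    rw [hp, hq]
  inv_mem' := by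
    intro p hp
    simp only [Set.mem_ofPred_eq, Prod.fst_inv, Prod.snd_inv, map_inv, inv_pow] at *
    rw [hp]

/-- The pairs `(β⁴, N(β))` for `β` in `K[√(-D)]ˣ`. -/
def kummerTrivial {K : Type*} [Field K] (D : K) : Subgroup ((SqrtAlg (-D))ˣ × Kˣ) :=
  ((powMonoidHom 4).prod (Units.map QuadraticAlgebra.norm)).range

/-- `{(α, c) : N(α) = c⁴} / {(β⁴, N(β))}`. -/
abbrev KummerGroup {K : Type*} [Field K] (D : K) : Type _ :=
  kummerData D ⧸ (kummerTrivial D).subgroupOf (kummerData D)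

/-! ### Quartic algebras -/

/-- The algebra `K[√d, √(u + v√d)]`, a quadratic extension of the quadratic extension `K[√d]`. -/
abbrev BiquadAlg {K : Type*} [Field K] (d u v : K) : Type _ :=
  SqrtAlg (R := SqrtAlg d) ⟨u, v⟩

/-- The étale algebra `K[√d, √(u + v√d)]`, with its structure of quadratic extension of `K[√d]`,
corresponds to the cocycle `σ` with values in the module `M = ℤ/4` attached to `K[√D]`: its
coordinates `ι_x` can be labelled by `x ∈ M` such that `g ∘ ι_x = ι_{g x + σ(g)}` for all
`g ∈ G_K`, and such that `ι_x` and `ι_y` agree on `K[√d]` exactly when `x` and `y` are equal or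
opposite vertices of the square `M` (that is, `2 x = 2 y`). -/
def CorrespondsTo {K : Type*} [Field K] (D : K) (σ : AbsGal K → CyclicFour D) (d u v : K) :
    Prop :=
  Algebra.Etale K (BiquadAlg d u v) ∧
  ∃ ι : CyclicFour D ≃ Coord K (BiquadAlg d u v),
    (∀ (g : AbsGal K) (x : CyclicFour D) (z : BiquadAlg d u v),
      g (ι x z) = ι (g • x + σ g) z) ∧
    (∀ x y : CyclicFour D, 2 • x = 2 • y ↔
      ∀ z : SqrtAlg d, ι x (algebraMap (SqrtAlg d) (BiquadAlg d u v) z) =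
        ι y (algebraMap (SqrtAlg d) (BiquadAlg d u v) z))

/-! Fix `i` with `i ^ 2 = -1` and a coordinate `e` of `K[√(-D)]` in `K^sep`. Since `i√(-D)` is a
square root of `D`, the sign by which `g` acts on `M` is the product of its signs on `i` and on
`√(-D)`. Hence `x ↦ (i^x, i^(-x))` identifies `M`, Galois-equivariantly, with the kernel of `β ↦
(β^4, N β)` on the units of `K^sep ⊗ K[√(-D)]`, where Galois also permutes the two factors. The
isomorphism is Kummer theory for this map: a pair `(α, c)` has a preimage `(β, γ)` with `β^4 = e α`
and `βγ = c`, and Galois moves it through a cocycle `σ`. This relation is `Represents`. Other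
choices of `β` change `σ` by coboundaries (`Represents.sub_eq_coboundary`), `σ = 0` means that `(β,
γ)` descends to `K[√(-D)]` (`Represents.eq_of_zero`), and every cocycle arises by Hilbert 90
(`exists_eigenvector`, `Represents.exists_of_cocycle`).

The quartic algebra comes from the sums `r_x = i^x β + i^(-x) γ`, which Galois permutes by `x ↦ gx +
σ(g)`. Here `r_x^2 = 2c ± (β^2 + γ^2)` and `(β^2 + γ^2)^2 = β^4 + γ^4 + 2c^2 = 2a + 2c^2`. The
condition `b ≠ 0` gives `a ≠ ±c^2`, which makes the four sums distinct and the algebra étale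
(`Represents.correspondsTo`). -/

/-! ### Powers of `i` indexed by `ℤ/4` -/

section
variable {K : Type*} [Field K] {D : K}

/-- The identity map `ℤ/4 → M`. -/
def CyclicFour.ofZMod (x : ZMod 4) : CyclicFour D := x

/-- The power `i ^ x` of a fourth root of unity `i`, for `x ∈ ℤ/4`. -/
def CyclicFour.rootPow {S : Type*} [Monoid S] (i : S) (x : CyclicFour D) : S :=
  i ^ ZMod.val (n := 4) x

namespace CyclicFour

section rootPow
variable {S : Type*} [Field S] {i : S}

theorem pow_four_eq_one (hi : i ^ 2 = -1) : i ^ 4 = 1 := by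
  rw [show i ^ 4 = (i ^ 2) ^ 2 by ring, hi]; ring

theorem rootPow_zero : rootPow i (0 : CyclicFour D) = 1 := pow_zero i

theorem rootPow_add (hi : i ^ 2 = -1) (x y : CyclicFour D) :
    rootPow i (x + y) = rootPow i x * rootPow i y := by
  unfold rootPow
  rw [← pow_add]
  have h : ZMod.val (n := 4) (x + y) = (ZMod.val (n := 4) x + ZMod.val (n := 4) y) % 4 :=
    ZMod.val_add (n := 4) x y
  rw [h, ← pow_eq_pow_mod _ (pow_four_eq_one hi)]

theorem rootPow_mul_rootPow_neg (hi : i ^ 2 = -1) (x : CyclicFour D) :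
    rootPow i x * rootPow i (-x) = 1 := by
  rw [← rootPow_add hi, add_neg_cancel, rootPow_zero]

theorem rootPow_ne_zero (hi : i ^ 2 = -1) (x : CyclicFour D) : rootPow i x ≠ 0 :=
  left_ne_zero_of_mul_eq_one (rootPow_mul_rootPow_neg hi x)

theorem rootPow_neg (hi : i ^ 2 = -1) (x : CyclicFour D) :
    rootPow i (-x) = (rootPow i x)⁻¹ :=
  eq_inv_of_mul_eq_one_right (rootPow_mul_rootPow_neg hi x)

theorem rootPow_pow_four (hi : i ^ 2 = -1) (x : CyclicFour D) : rootPow i x ^ 4 = 1 := by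
  unfold rootPow
  rw [← pow_mul, mul_comm, pow_mul, pow_four_eq_one hi, one_pow]

theorem rootPow_one : rootPow i (ofZMod 1 : CyclicFour D) = i :=
  pow_one i

theorem rootPow_two (hi : i ^ 2 = -1) : rootPow i (ofZMod 2 : CyclicFour D) = -1 :=
  hi

theorem exists_rootPow_eq (hi : i ^ 2 = -1) {z : S} (hz : z ^ 4 = 1) :
    ∃ x : CyclicFour D, rootPow i x = z := by
  have h : (z - 1) * (z + 1) * ((z - i) * (z + i)) = 0 := by
    linear_combination hz + (1 - z ^ 2) * hi
  simp only [mul_eq_zero, sub_eq_zero, add_eq_zero_iff_eq_neg] at h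
  rcases h with (rfl | rfl) | rfl | rfl
  · exact ⟨0, rootPow_zero⟩
  · exact ⟨_, rootPow_two hi⟩
  · exact ⟨_, rootPow_one⟩
  · exact ⟨ofZMod 2 + ofZMod 1, by
      rw [rootPow_add hi, rootPow_two hi, rootPow_one, neg_one_mul]⟩

theorem rootPow_injective (h2 : (2 : S) ≠ 0) (hi : i ^ 2 = -1) :
    Function.Injective (rootPow i : CyclicFour D → S) := by
  have h1 : (-1 : S) ≠ 1 := fun h => h2 (by linear_combination -h)
  have key : ∀ x : CyclicFour D, rootPow i x = 1 → x = 0 := by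
    intro x hx
    change ZMod 4 at x
    have h3 : i ≠ 1 := by rintro rfl; exact h1 (by simpa using hi.symm)
    have h4 : i ≠ -1 := by rintro rfl; exact h1 (by simpa using hi.symm)
    have hx' : i ^ x.val = 1 := hx
    change x = 0
    fin_cases x
    · rfl
    · exact absurd ((pow_one i).symm.trans hx') h3
    · exact absurd (hi.symm.trans hx') h1
    · refine absurd ?_ h4
      have : i ^ 3 = 1 := hx'
      linear_combination i * hi - this
  intro x y hxy
  refine sub_eq_zero.mp (key _ ?_)
  rw [sub_eq_add_neg, rootPow_add hi, hxy, rootPow_mul_rootPow_neg hi]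

theorem rootPow_neg_base (hi : i ^ 2 = -1) (x : CyclicFour D) :
    rootPow (-i) x = rootPow i (-x) := by
  have h : -i = i⁻¹ := by
    refine eq_inv_of_mul_eq_one_right ?_
    linear_combination -hi
  rw [rootPow_neg hi, h]
  exact inv_pow i _

end rootPow

theorem two_smul_eq_iff {x y : CyclicFour D} :
    2 • x = 2 • y ↔ x = y ∨ x = y + ofZMod 2 :=
  (by decide : ∀ x y : ZMod 4, 2 • x = 2 • y ↔ x = y ∨ x = y + 2) x y

end CyclicFour

open QuadraticAlgebra CyclicFour

/-! ### Coordinates of quadratic algebras, the Galois action on powers of `i`, and descent -/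

theorem coord_apply {d : K} (e : Coord K (SqrtAlg d)) (z : SqrtAlg d) :
    e z = algebraMap K _ z.re + algebraMap K _ z.im * e omega := by
  conv_lhs => rw [← mk_eta z, mk_eq_add_smul_omega]
  simp [Algebra.smul_def]

theorem coord_star {d : K} (e : Coord K (SqrtAlg d)) (z : SqrtAlg d) :
    e (star z) = algebraMap K _ z.re - algebraMap K _ z.im * e omega := by
  rw [coord_apply]; simp [sub_eq_add_neg]

theorem coord_mul_coord_star {d : K} (e : Coord K (SqrtAlg d)) (z : SqrtAlg d) :
    e z * e (star z) = algebraMap K _ (norm z) := by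
  rw [← map_mul, ← algebraMap_norm_eq_mul_star, AlgHom.commutes]

theorem exists_coord (h2 : (2 : SeparableClosure K) ≠ 0) (d : K) :
    Nonempty (Coord K (SqrtAlg d)) := by
  have : NeZero ((2 : ℕ) : SeparableClosure K) := ⟨h2⟩
  obtain ⟨z, hz⟩ := IsSepClosed.exists_pow_nat_eq (algebraMap K (SeparableClosure K) d) 2
  exact ⟨QuadraticAlgebra.lift ⟨z, by rw [← pow_two, hz]; simp [Algebra.smul_def]⟩⟩

theorem exists_coord_omega_eq {d : K} {δ : SeparableClosure K} (h : δ ^ 2 = algebraMap K _ d) :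
    ∃ e : Coord K (SqrtAlg d), e omega = δ :=
  ⟨QuadraticAlgebra.lift ⟨δ, by rw [← pow_two, h]; simp [Algebra.smul_def]⟩, by
    simp [QuadraticAlgebra.lift]⟩

theorem fixesCoords_iff_of_sq {d : K} {δ : SeparableClosure K} (h : δ ^ 2 = algebraMap K _ d)
    (g : AbsGal K) : FixesCoords d g ↔ g δ = δ := by
  rw [fixesCoords_iff]
  constructor
  · intro H
    obtain ⟨e, rfl⟩ := exists_coord_omega_eq h
    exact H e
  · intro H ι
    rcases sq_eq_sq_iff_eq_or_eq_neg.mp ((coord_omega_sq d ι).trans h.symm) with e | e <;>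
      simp [e, H]

theorem map_eq_or_eq_neg {d : K} {δ : SeparableClosure K} (h : δ ^ 2 = algebraMap K _ d)
    (g : AbsGal K) : g δ = δ ∨ g δ = -δ :=
  sq_eq_sq_iff_eq_or_eq_neg.mp (by rw [← map_pow, h, AlgEquiv.commutes])

theorem ne_neg_of_sq {S : Type*} [Field S] (h2 : (2 : S) ≠ 0) {δ : S} (h : δ ≠ 0) : δ ≠ -δ := by
  intro H
  exact (mul_ne_zero h2 h) (by linear_combination H)

variable {i : SeparableClosure K} {e : Coord K (SqrtAlg (-D))} {g h : AbsGal K}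

theorem coord_omega_ne_zero (hD : D ≠ 0) : e omega ≠ 0 := by
  intro H
  have := coord_omega_sq (-D) e
  rw [H] at this
  simp [hD] at this

theorem smul_cyclicFour_eq_of_map (hi : i ^ 2 = -1) (hg : g (i * e omega) = i * e omega)
    (x : CyclicFour D) : g • x = x := by
  change quadSign D g • x = x
  have h : (i * e omega) ^ 2 = algebraMap K _ D := by
    rw [mul_pow, hi, coord_omega_sq, map_neg]; ring
  rw [quadSign, if_pos ((fixesCoords_iff_of_sq h g).2 hg), one_smul]

theorem smul_cyclicFour_eq_neg_of_map (h2 : (2 : SeparableClosure K) ≠ 0) (hD : D ≠ 0)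
    (hi : i ^ 2 = -1) (hg : g (i * e omega) = -(i * e omega)) (x : CyclicFour D) :
    g • x = -x := by
  change quadSign D g • x = -x
  have h : (i * e omega) ^ 2 = algebraMap K _ D := by
    rw [mul_pow, hi, coord_omega_sq, map_neg]; ring
  have h0 : i * e omega ≠ 0 := mul_ne_zero (by rintro rfl; simp at hi) (coord_omega_ne_zero hD)
  rw [quadSign, if_neg, neg_one_smul]
  rw [fixesCoords_iff_of_sq h g, hg]
  exact (ne_neg_of_sq h2 h0).symm

theorem map_rootPow_base (x : CyclicFour D) : g (rootPow i x) = rootPow (g i) x := by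
  simp [rootPow]

theorem map_eq_or_eq_neg_of_sq_eq_neg_one (hi : i ^ 2 = -1) : g i = i ∨ g i = -i :=
  map_eq_or_eq_neg (d := -1) (by simpa using hi) g

/-- When `g` fixes `√(-D)`, its signs on `i` and on `i√(-D)`, hence on `M`, coincide. -/
theorem map_rootPow_of_fixed (h2 : (2 : SeparableClosure K) ≠ 0) (hD : D ≠ 0)
    (hi : i ^ 2 = -1) (hg : g (e omega) = e omega) (x : CyclicFour D) :
    g (rootPow i x) = rootPow i (g • x) := by
  rw [map_rootPow_base]
  rcases map_eq_or_eq_neg_of_sq_eq_neg_one (g := g) hi with h | h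
  · rw [h, smul_cyclicFour_eq_of_map (e := e) hi (by rw [map_mul, h, hg])]
  · rw [h, smul_cyclicFour_eq_neg_of_map (e := e) h2 hD hi (by rw [map_mul, h, hg]; ring),
      rootPow_neg_base hi]

/-- Here the two signs are opposite. The extra inversion is what swapping the components of `(i^x,
i^(-x))` undoes. -/
theorem map_rootPow_of_swapped (h2 : (2 : SeparableClosure K) ≠ 0) (hD : D ≠ 0)
    (hi : i ^ 2 = -1) (hg : g (e omega) = -e omega) (x : CyclicFour D) :
    g (rootPow i x) = rootPow i (-(g • x)) := by
  rw [map_rootPow_base]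
  rcases map_eq_or_eq_neg_of_sq_eq_neg_one (g := g) hi with h | h
  · rw [h, smul_cyclicFour_eq_neg_of_map (e := e) h2 hD hi (by rw [map_mul, h, hg]; ring), neg_neg]
  · rw [h, smul_cyclicFour_eq_of_map (e := e) hi (by rw [map_mul, h, hg]; ring),
      rootPow_neg_base hi]

theorem map_coord_of_fixed (hg : g (e omega) = e omega) (z : SqrtAlg (-D)) : g (e z) = e z := by
  rw [coord_apply, map_add, map_mul, hg, AlgEquiv.commutes, AlgEquiv.commutes]

theorem map_coord_of_swapped (hg : g (e omega) = -e omega) (z : SqrtAlg (-D)) :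
    g (e z) = e (star z) := by
  rw [coord_star, coord_apply, map_add, map_mul, hg, AlgEquiv.commutes, AlgEquiv.commutes]
  ring

theorem eq_of_coord_eq (h2 : (2 : SeparableClosure K) ≠ 0) (hD : D ≠ 0) {z w : SqrtAlg (-D)}
    (h : e z = e w) (h' : e (star z) = e (star w)) : z = w := by
  rw [coord_apply, coord_apply e w] at h
  rw [coord_star, coord_star] at h'
  have inj := (algebraMap K (SeparableClosure K)).injective
  ext
  · refine inj (mul_left_cancel₀ h2 ?_)
    linear_combination h + h'
  · refine inj (mul_left_cancel₀ (mul_ne_zero h2 (coord_omega_ne_zero (e := e) hD)) ?_)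
    linear_combination h - h'

/-- Galois descent from `K^sep × K^sep` to `K[√(-D)]`. -/
theorem exists_coord_eq (h2 : (2 : SeparableClosure K) ≠ 0) (hD : D ≠ 0)
    {x y : SeparableClosure K}
    (hf : ∀ g : AbsGal K, g (e omega) = e omega → g x = x ∧ g y = y)
    (hs : ∀ g : AbsGal K, g (e omega) = -e omega → g x = y ∧ g y = x) :
    ∃ z : SqrtAlg (-D), e z = x ∧ e (star z) = y := by
  have hε := coord_omega_ne_zero (e := e) hD
  have h2' (g : AbsGal K) : g 2 = 2 := map_ofNat g 2
  -- The two quotients fixed here and in `h3` are the coefficients of `1` and `√(-D)` in the element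
  -- sought.
  have h1 : ∀ g : AbsGal K, g ((x + y) / 2) = (x + y) / 2 := by
    intro g
    rcases map_eq_or_eq_neg (coord_omega_sq _ e) g with h | h
    · rw [map_div₀, map_add, (hf g h).1, (hf g h).2, h2']
    · rw [map_div₀, map_add, (hs g h).1, (hs g h).2, h2', add_comm]
  have h3 : ∀ g : AbsGal K, g ((x - y) / (2 * e omega)) = (x - y) / (2 * e omega) := by
    intro g
    rcases map_eq_or_eq_neg (coord_omega_sq _ e) g with h | h
    · rw [map_div₀, map_sub, map_mul, (hf g h).1, (hf g h).2, h2', h]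
    · rw [map_div₀, map_sub, map_mul, (hs g h).1, (hs g h).2, h2', h]
      field_simp
      ring
  obtain ⟨a, ha⟩ := (InfiniteGalois.mem_range_algebraMap_iff_fixed _).2 h1
  obtain ⟨b, hb⟩ := (InfiniteGalois.mem_range_algebraMap_iff_fixed _).2 h3
  refine ⟨⟨a, b⟩, ?_, ?_⟩
  · rw [coord_apply, ha, hb]; field_simp; ring
  · rw [coord_star, ha, hb]; field_simp; ring

/-- The subgroup fixing `K(s)` is open, and `f` is constant on its left cosets. -/
theorem isLocallyConstant_of_finite {X : Type*} {f : AbsGal K → X}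
    {s : Set (SeparableClosure K)} (hs : s.Finite)
    (H : ∀ g h : AbsGal K, (∀ x ∈ s, g x = h x) → f g = f h) : IsLocallyConstant f := by
  rw [IsLocallyConstant.iff_exists_open]
  intro g
  have : FiniteDimensional K (IntermediateField.adjoin K s) := by
    have := hs.to_subtype
    exact IntermediateField.finiteDimensional_adjoin fun x _ => Algebra.IsIntegral.isIntegral x
  have ho := (IntermediateField.fixingSubgroup_isOpen (IntermediateField.adjoin K s)).leftCoset g
  refine ⟨_, ho, ⟨1, one_mem _, mul_one g⟩, ?_⟩
  rintro _ ⟨h, hh, rfl⟩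
  refine H _ _ fun x hx => ?_
  have := (IntermediateField.mem_fixingSubgroup_iff _ _).1 hh x
    (IntermediateField.subset_adjoin K s hx)
  change g (h x) = g x
  rw [this]

end

/-! ### Kummer theory: fourth roots and cocycles -/

section
open QuadraticAlgebra CyclicFour
variable {K : Type*} [Field K] {D : K}
variable {i : SeparableClosure K} {e : Coord K (SqrtAlg (-D))} {g h : AbsGal K}

/-- The fourth root `(β, c / β)` of `(e α, e (star α))`, with product `c`, is acted on by the
Galois group through `σ`: applying `g` to it, and swapping the two components when `g` swaps the
coordinates of `K[√(-D)]`, multiplies it by `(i ^ σ g, i ^ (-σ g))`. -/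
structure Represents (i : SeparableClosure K) (e : Coord K (SqrtAlg (-D)))
    (σ : AbsGal K → CyclicFour D) (α : SqrtAlg (-D)) (c : K) (β : SeparableClosure K) : Prop where
  pow_four : β ^ 4 = e α
  fixed : ∀ g : AbsGal K, g (e omega) = e omega → g β = rootPow i (σ g) * β
  swapped : ∀ g : AbsGal K, g (e omega) = -e omega →
    g β * (rootPow i (σ g) * β) = algebraMap K _ c

namespace Represents

variable {σ τ : AbsGal K → CyclicFour D} {α α' : SqrtAlg (-D)} {c c' : K}
  {β β' : SeparableClosure K}

theorem mul (hi : i ^ 2 = -1) (H : Represents i e σ α c β) (H' : Represents i e τ α' c' β') :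
    Represents i e (σ + τ) (α * α') (c * c') (β * β') where
  pow_four := by rw [mul_pow, H.pow_four, H'.pow_four, map_mul]
  fixed g hg := by
    rw [map_mul, H.fixed g hg, H'.fixed g hg, Pi.add_apply, rootPow_add hi]; ring
  swapped g hg := by
    rw [map_mul, map_mul, ← H.swapped g hg, ← H'.swapped g hg, Pi.add_apply, rootPow_add hi]; ring

theorem add_coboundary (h2 : (2 : SeparableClosure K) ≠ 0) (hD : D ≠ 0) (hi : i ^ 2 = -1)
    (H : Represents i e σ α c β) (x : CyclicFour D) (hτ : ∀ g, τ g = σ g + (g • x - x)) :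
    Represents i e τ α c (rootPow i x * β) where
  pow_four := by rw [mul_pow, H.pow_four, rootPow_pow_four hi, one_mul]
  fixed g hg := by
    rw [map_mul, H.fixed g hg, map_rootPow_of_fixed h2 hD hi hg, hτ, sub_eq_add_neg,
      rootPow_add hi, rootPow_add hi]
    linear_combination -rootPow i (g • x) * rootPow i (σ g) * β * rootPow_mul_rootPow_neg hi x
  swapped g hg := by
    rw [map_mul, ← H.swapped g hg, map_rootPow_of_swapped h2 hD hi hg, hτ, sub_eq_add_neg,
      rootPow_add hi, rootPow_add hi]
    linear_combination g β * rootPow i (σ g) * β * (rootPow i (g • x) * rootPow i (-(g • x)) *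
      rootPow_mul_rootPow_neg hi x + rootPow_mul_rootPow_neg hi (g • x))

/-- Two fourth roots of `e α` differ by some `i^x`, and `x` gives the coboundary. So the class of
`σ` depends only on `(α, c)`. -/
theorem sub_eq_coboundary (h2 : (2 : SeparableClosure K) ≠ 0) (hD : D ≠ 0) (hi : i ^ 2 = -1)
    (hβ : β ≠ 0) (H : Represents i e σ α c β) (H' : Represents i e τ α c β') :
    ∃ x : CyclicFour D, ∀ g, τ g = σ g + (g • x - x) := by
  obtain ⟨x, hx⟩ := exists_rootPow_eq (D := D) hi (z := β' / β)
    (by rw [div_pow, H'.pow_four, ← H.pow_four, div_self (pow_ne_zero 4 hβ)])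
  have hx' : β' = rootPow i x * β := by rw [hx, div_mul_cancel₀ _ hβ]
  have H'' := H.add_coboundary h2 hD hi x (fun g => rfl)
  rw [← hx'] at H''
  have hβ' : β' ≠ 0 := by rw [hx']; exact mul_ne_zero (rootPow_ne_zero hi x) hβ
  refine ⟨x, fun g => rootPow_injective h2 hi ?_⟩
  rcases map_eq_or_eq_neg (coord_omega_sq _ e) g with hg | hg
  · exact mul_right_cancel₀ hβ' ((H'.fixed g hg).symm.trans (H''.fixed g hg))
  · exact mul_right_cancel₀ hβ' (mul_left_cancel₀ ((map_ne_zero g).2 hβ')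
      ((H'.swapped g hg).trans (H''.swapped g hg).symm))

theorem of_trivial (z : SqrtAlg (-D)) : Represents i e 0 (z ^ 4) (norm z) (e z) where
  pow_four := (map_pow e z 4).symm
  fixed g hg := by rw [map_coord_of_fixed hg, Pi.zero_apply, rootPow_zero, one_mul]
  swapped g hg := by
    rw [map_coord_of_swapped hg, Pi.zero_apply, rootPow_zero, one_mul, mul_comm,
      coord_mul_coord_star]

/-- For the zero cocycle the pair `(β, c / β)` is Galois-stable and descends to `K[√(-D)]`. This is
injectivity of the Kummer map modulo trivial pairs. -/
theorem eq_of_zero (h2 : (2 : SeparableClosure K) ≠ 0) (hD : D ≠ 0) (hβ : β ≠ 0)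
    (hc : norm α = c ^ 4) (H : Represents i e 0 α c β) :
    ∃ z : SqrtAlg (-D), z ^ 4 = α ∧ norm z = c := by
  obtain ⟨z, hz, hz'⟩ := exists_coord_eq (e := e) h2 hD (x := β) (y := algebraMap K _ c / β)
    (fun g hg => by
      have := H.fixed g hg
      rw [Pi.zero_apply, rootPow_zero, one_mul] at this
      exact ⟨this, by rw [map_div₀, this, AlgEquiv.commutes]⟩)
    (fun g hg => by
      have := H.swapped g hg
      rw [Pi.zero_apply, rootPow_zero, one_mul] at this
      have hgβ : g β ≠ 0 := (map_ne_zero g).2 hβ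
      refine ⟨eq_div_of_mul_eq hβ this, ?_⟩
      rw [map_div₀, AlgEquiv.commutes, ← this, mul_div_cancel_left₀ _ hgβ])
  refine ⟨z, eq_of_coord_eq (e := e) h2 hD ?_ ?_, ?_⟩
  · rw [map_pow, hz, H.pow_four]
  · have h1 := coord_mul_coord_star e α
    rw [star_pow, map_pow, hz', div_pow, div_eq_iff (pow_ne_zero 4 hβ), H.pow_four, mul_comm, h1,
      hc, map_pow]
  · apply (algebraMap K (SeparableClosure K)).injective
    rw [← coord_mul_coord_star e, hz, hz', mul_div_cancel₀ _ hβ]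

theorem exists_of_data (h2 : (2 : SeparableClosure K) ≠ 0) (hD : D ≠ 0) (hi : i ^ 2 = -1)
    (hc0 : c ≠ 0) (hc : norm α = c ^ 4) :
    ∃ σ : Z1 (AbsGal K) (CyclicFour D), ∃ β, β ≠ 0 ∧ Represents i e σ α c β := by
  have hαα := coord_mul_coord_star e α
  rw [hc, map_pow] at hαα
  have hc0' : algebraMap K (SeparableClosure K) c ≠ 0 := by simpa using hc0
  have h4 : NeZero ((4 : ℕ) : SeparableClosure K) :=
    ⟨by rw [show ((4 : ℕ) : SeparableClosure K) = 2 * 2 by norm_num]; exact mul_ne_zero h2 h2⟩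
  obtain ⟨β, hβ⟩ := IsSepClosed.exists_pow_nat_eq (e α) 4
  have hβ0 : β ≠ 0 := by
    rintro rfl
    rw [zero_pow (by norm_num)] at hβ
    rw [← hβ, zero_mul] at hαα
    exact pow_ne_zero 4 hc0' hαα.symm
  have ex : ∀ g : AbsGal K, ∃ x : CyclicFour D,
      (g (e omega) = e omega → g β = rootPow i x * β) ∧
      (g (e omega) = -e omega → g β * (rootPow i x * β) = algebraMap K _ c) := by
    intro g
    have hgβ : g β ≠ 0 := (map_ne_zero g).2 hβ0
    have hne := ne_neg_of_sq h2 (coord_omega_ne_zero (e := e) hD)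
    rcases map_eq_or_eq_neg (coord_omega_sq _ e) g with hg | hg
    · obtain ⟨x, hx⟩ := exists_rootPow_eq (D := D) hi (z := g β / β) (by
        rw [div_pow, ← map_pow, hβ, map_coord_of_fixed hg, ← hβ, div_self (pow_ne_zero 4 hβ0)])
      refine ⟨x, fun _ => by rw [hx, div_mul_cancel₀ _ hβ0], fun h => absurd (hg.symm.trans h) hne⟩
    -- The fourth power of `g β * β` is `e (star α) * e α = c ^ 4`.
    · obtain ⟨x, hx⟩ := exists_rootPow_eq (D := D) hi (z := algebraMap K _ c / (g β * β)) (by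
        rw [div_pow, mul_pow, ← map_pow g, hβ, map_coord_of_swapped hg, mul_comm (e (star α)), hαα,
          div_self (pow_ne_zero 4 hc0')])
      exact ⟨x, fun h => absurd (h.symm.trans hg) hne, fun _ => by rw [hx]; field_simp⟩
  -- The value `σ g` is determined by `g` on `√(-D)` and `β`. This yields both the cocycle identity
  -- and local constancy.
  have uniq : ∀ (g : AbsGal K) (x y : CyclicFour D),
      ((g (e omega) = e omega → g β = rootPow i x * β) ∧
      (g (e omega) = -e omega → g β * (rootPow i x * β) = algebraMap K _ c)) →
      ((g (e omega) = e omega → g β = rootPow i y * β) ∧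
      (g (e omega) = -e omega → g β * (rootPow i y * β) = algebraMap K _ c)) → x = y := by
    intro g x y hx hy
    apply rootPow_injective h2 hi
    rcases map_eq_or_eq_neg (coord_omega_sq _ e) g with hg | hg
    · exact mul_right_cancel₀ hβ0 ((hx.1 hg).symm.trans (hy.1 hg))
    · exact mul_right_cancel₀ hβ0 (mul_left_cancel₀ ((map_ne_zero g).2 hβ0)
        ((hx.2 hg).trans (hy.2 hg).symm))
  choose σ hσ using ex
  have hcocycle : ∀ g h : AbsGal K, σ (g * h) = σ g + g • σ h := by
    intro g h
    refine uniq (g * h) _ _ (hσ _) ?_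
    have hne := ne_neg_of_sq h2 (coord_omega_ne_zero (e := e) hD)
    rw [AlgEquiv.mul_apply, AlgEquiv.mul_apply, rootPow_add hi]
    rcases map_eq_or_eq_neg (coord_omega_sq _ e) g with hg | hg <;>
      rcases map_eq_or_eq_neg (coord_omega_sq _ e) h with hh | hh
    · rw [hh, hg]
      refine ⟨fun _ => ?_, fun H => absurd H hne⟩
      rw [(hσ h).1 hh, map_mul, (hσ g).1 hg, map_rootPow_of_fixed h2 hD hi hg]
      ring
    · rw [hh, map_neg, hg]
      refine ⟨fun H => absurd H.symm hne, fun _ => ?_⟩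
      have := congrArg g ((hσ h).2 hh)
      rw [map_mul, map_mul, (hσ g).1 hg, map_rootPow_of_fixed h2 hD hi hg,
        AlgEquiv.commutes] at this
      rw [← this]
      ring
    · rw [hh, hg]
      refine ⟨fun H => absurd H.symm hne, fun _ => ?_⟩
      rw [(hσ h).1 hh, map_mul, map_rootPow_of_swapped h2 hD hi hg, ← (hσ g).2 hg]
      linear_combination g β * rootPow i (σ g) * β * rootPow_mul_rootPow_neg hi (g • σ h)
    · rw [hh, map_neg, hg, neg_neg]
      refine ⟨fun _ => ?_, fun H => absurd H hne⟩
      have := congrArg g ((hσ h).2 hh)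
      rw [map_mul, map_mul, map_rootPow_of_swapped h2 hD hi hg, AlgEquiv.commutes,
        ← (hσ g).2 hg] at this
      refine mul_right_cancel₀ ((map_ne_zero g).2 hβ0) ?_
      linear_combination rootPow i (g • σ h) * this -
        g (h β) * g β * rootPow_mul_rootPow_neg hi (g • σ h)
  refine ⟨⟨σ, ?_, hcocycle⟩, β, hβ0, hβ, fun g => (hσ g).1, fun g => (hσ g).2⟩
  refine isLocallyConstant_of_finite (s := {e omega, β}) (Set.toFinite _) fun g h H => ?_
  refine uniq g _ _ (hσ g) ?_
  rw [H (e omega) (by simp), H β (by simp)]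
  exact hσ h

end Represents

/-- A form of Hilbert's Theorem 90, by linear independence of embeddings. -/
theorem exists_eigenvector (h2 : (2 : SeparableClosure K) ≠ 0) (hD : D ≠ 0) (hi : i ^ 2 = -1)
    (σ : Z1 (AbsGal K) (CyclicFour D)) :
    ∃ β : SeparableClosure K, β ≠ 0 ∧
      ∀ h : AbsGal K, h (e omega) = e omega → h β = rootPow i (σ.1 h) * β := by
  classical
  obtain ⟨hlc, hσ⟩ := σ.2
  have hσ1 : σ.1 1 = 0 := by simpa using hσ 1 1
  have hlc' : IsLocallyConstant fun g : AbsGal K => (σ.1 g, g (e omega)) :=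
    hlc.prodMk (isLocallyConstant_of_finite (s := {e omega}) (Set.toFinite _)
      fun g h H => H _ rfl)
  have hU := (hlc'.isOpen_fiber (σ.1 1, e omega)).mem_nhds (show (1 : AbsGal K) ∈ _ from rfl)
  obtain ⟨E, _, hE⟩ := (krullTopology_mem_nhds_one_iff _ _ _).1 hU
  have ext_ex : ∀ φ : E →ₐ[K] SeparableClosure K, ∃ g : AbsGal K, ∀ x : E, g x = φ x := by
    intro φ
    refine ⟨Algebra.IsAlgebraic.algEquivEquivAlgHom K _ |>.symm
      (φ.liftNormal (SeparableClosure K)), fun x => ?_⟩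
    exact φ.liftNormal_commutes (SeparableClosure K) x
  choose lift hlift using ext_ex
  have hagree : ∀ g h : AbsGal K, (∀ x : E, g x = h x) →
      σ.1 g = σ.1 h ∧ g (e omega) = h (e omega) := by
    intro g h H
    have hmem : g⁻¹ * h ∈ E.fixingSubgroup := by
      rw [IntermediateField.mem_fixingSubgroup_iff]
      intro x hx
      rw [AlgEquiv.mul_apply, ← H ⟨x, hx⟩]
      exact g.symm_apply_apply x
    have := hE hmem
    simp only [Set.mem_ofPred_eq, Prod.mk.injEq] at this
    have hh : h = g * (g⁻¹ * h) := by group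
    constructor
    · rw [hh, hσ, this.1, hσ1, smul_zero, add_zero]
    · conv_rhs => rw [hh, AlgEquiv.mul_apply, this.2]
  -- Coefficients of a twisted trace from `E`, restricted to the embeddings whose lifts fix `√(-D)`.
  -- By `hagree` the choice of lift does not matter.
  let coeff : (E →ₐ[K] SeparableClosure K) → SeparableClosure K := fun φ =>
    if lift φ (e omega) = e omega then rootPow i (-σ.1 (lift φ)) else 0
  -- The inclusion of `E` has coefficient `1`, so the combination of embeddings is not identically
  -- zero.
  have hcoeff : ∃ γ : E, ∑ φ, coeff φ * φ γ ≠ 0 := by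
    by_contra! H
    have li := Fintype.linearIndependent_iff.1
      (linearIndependent_algHom_toLinearMap K E (SeparableClosure K)) coeff
      (LinearMap.ext fun γ => by simpa using H γ) E.val
    have h1 := hagree (lift E.val) 1 (fun x => hlift E.val x)
    simp only [coeff, h1.1, h1.2, hσ1, neg_zero, rootPow_zero] at li
    simp at li
  obtain ⟨γ, hγ⟩ := hcoeff
  refine ⟨_, hγ, fun h hh => ?_⟩
  rw [map_sum, Finset.mul_sum]
  -- Postcomposition with `h` permutes the embeddings; the cocycle identity turns the change of
  -- coefficients into the factor `i^(σ h)`.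
  refine Fintype.sum_equiv (AlgEquiv.refl.arrowCongr h) _ _ fun φ => ?_
  have hc := hagree (lift (AlgEquiv.refl.arrowCongr h φ)) (h * lift φ) (fun x => by
    rw [hlift, AlgEquiv.mul_apply, hlift]; rfl)
  have hφ : (AlgEquiv.refl.arrowCongr h φ) γ = h (φ γ) := rfl
  rw [map_mul, hφ, ← mul_assoc]
  congr 1
  simp only [coeff, hc.1, hc.2, AlgEquiv.mul_apply]
  have hiff : h (lift φ (e omega)) = e omega ↔ lift φ (e omega) = e omega := by
    conv_lhs => rw [← hh]
    rw [h.injective.eq_iff, hh]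
  simp only [hiff]
  split_ifs with hl
  · rw [map_rootPow_of_fixed h2 hD hi hh, hσ, smul_neg, neg_add, rootPow_add hi, ← mul_assoc,
      rootPow_mul_rootPow_neg hi, one_mul]
  · rw [map_zero, mul_zero]

/-- With `β` an eigenvector, `g β * i^(σ g) * β` is the same for every `g` that swaps `±√(-D)`, so
it is Galois-fixed and supplies `c`. Then `(β^4, c^4 / β^4)` descends to `α`. -/
theorem Represents.exists_of_cocycle (h2 : (2 : SeparableClosure K) ≠ 0) (hD : D ≠ 0)
    (hi : i ^ 2 = -1) (σ : Z1 (AbsGal K) (CyclicFour D)) :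
    ∃ (α : SqrtAlg (-D)) (c : K) (β : SeparableClosure K), c ≠ 0 ∧ norm α = c ^ 4 ∧ β ≠ 0 ∧
      Represents i e σ α c β := by
  obtain ⟨β, hβ0, hβ⟩ := exists_eigenvector (e := e) h2 hD hi σ
  have hσ := σ.2.2
  have hc : ∃ c : K, c ≠ 0 ∧ ∀ g : AbsGal K, g (e omega) = -e omega →
      g β * (rootPow i (σ.1 g) * β) = algebraMap K _ c := by
    by_cases hex : ∃ g₀ : AbsGal K, g₀ (e omega) = -e omega
    · obtain ⟨g₀, hg₀⟩ := hex
      have key : ∀ g : AbsGal K, g (e omega) = -e omega →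
          g β * (rootPow i (σ.1 g) * β) = g₀ β * (rootPow i (σ.1 g₀) * β) := by
        intro g hg
        have hh : (g₀⁻¹ * g) (e omega) = e omega := by
          apply g₀.injective
          rw [← AlgEquiv.mul_apply, mul_inv_cancel_left, hg, hg₀]
        have h1 := congrArg g₀ (hβ _ hh)
        rw [← AlgEquiv.mul_apply, mul_inv_cancel_left, map_mul,
          map_rootPow_of_swapped h2 hD hi hg₀] at h1
        have h3 := hσ g₀ (g₀⁻¹ * g)
        rw [mul_inv_cancel_left] at h3
        rw [h1, h3, rootPow_add hi]
        linear_combination g₀ β * rootPow i (σ.1 g₀) * β *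
          rootPow_mul_rootPow_neg hi (g₀ • σ.1 (g₀⁻¹ * g))
      have hfix : ∀ h : AbsGal K, h (g₀ β * (rootPow i (σ.1 g₀) * β)) =
          g₀ β * (rootPow i (σ.1 g₀) * β) := by
        intro h
        have h3 := hσ h g₀
        rcases map_eq_or_eq_neg (coord_omega_sq _ e) h with hh | hh
        · have h4 := key (h * g₀) (by rw [AlgEquiv.mul_apply, hg₀, map_neg, hh])
          rw [AlgEquiv.mul_apply, h3, rootPow_add hi] at h4
          rw [map_mul, map_mul, map_rootPow_of_fixed h2 hD hi hh, hβ h hh, ← h4]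
          ring
        · have h4 := hβ (h * g₀) (by rw [AlgEquiv.mul_apply, hg₀, map_neg, hh, neg_neg])
          rw [AlgEquiv.mul_apply, h3, rootPow_add hi] at h4
          rw [map_mul, map_mul, map_rootPow_of_swapped h2 hD hi hh, h4, ← key h hh]
          linear_combination h β * rootPow i (σ.1 h) * β * rootPow_mul_rootPow_neg hi (h • σ.1 g₀)
      obtain ⟨c, hc⟩ := (InfiniteGalois.mem_range_algebraMap_iff_fixed _).2 hfix
      refine ⟨c, ?_, fun g hg => by rw [hc, key g hg]⟩
      rintro rfl
      rw [map_zero] at hc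
      exact mul_ne_zero ((map_ne_zero g₀).2 hβ0) (mul_ne_zero (rootPow_ne_zero hi _) hβ0) hc.symm
    -- If no `g` swaps the coordinates, the condition on `c` is vacuous and any nonzero value
    -- serves.
    · exact ⟨1, one_ne_zero, fun g hg => absurd ⟨g, hg⟩ hex⟩
  obtain ⟨c, hc0, hc⟩ := hc
  have hfixed : ∀ g : AbsGal K, g (e omega) = e omega → g (β ^ 4) = β ^ 4 := fun g hg => by
    rw [map_pow, hβ g hg, mul_pow, rootPow_pow_four hi, one_mul]
  have hswap : ∀ g : AbsGal K, g (e omega) = -e omega →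
      g (β ^ 4) * β ^ 4 = algebraMap K _ c ^ 4 := fun g hg => by
    rw [← hc g hg, map_pow, mul_pow, mul_pow, rootPow_pow_four hi, one_mul]
  have hβ4 : β ^ 4 ≠ 0 := pow_ne_zero 4 hβ0
  obtain ⟨α, hα, hα'⟩ := exists_coord_eq (e := e) h2 hD (x := β ^ 4)
    (y := algebraMap K _ c ^ 4 / β ^ 4)
    (fun g hg => ⟨hfixed g hg, by rw [map_div₀, hfixed g hg, map_pow, AlgEquiv.commutes]⟩)
    (fun g hg => by
      refine ⟨eq_div_of_mul_eq hβ4 (hswap g hg), ?_⟩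
      rw [map_div₀, map_pow g, AlgEquiv.commutes, ← hswap g hg,
        mul_div_cancel_left₀ _ ((map_ne_zero g).2 hβ4)])
  refine ⟨α, c, β, hc0, ?_, hβ0, hα.symm, hβ, hc⟩
  apply (algebraMap K (SeparableClosure K)).injective
  rw [← coord_mul_coord_star e, hα, hα', mul_div_cancel₀ _ hβ4, map_pow]

end

/-! ### The quartic algebra and its coordinates -/

section
open QuadraticAlgebra CyclicFour
variable {K : Type*} [Field K] {D : K}
variable {i : SeparableClosure K} {e : Coord K (SqrtAlg (-D))}

/-- If two lifts send `√d` to `s` and `s + η` with `η^2 = 0`, equality of squares gives `2sη = 0`,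
and `2s` is a unit. -/
theorem formallyUnramified_sqrtAlg {R : Type*} [CommRing R] {d : R} (h2 : IsUnit (2 : R))
    (hd : IsUnit d) : Algebra.FormallyUnramified R (SqrtAlg d) := by
  rw [Algebra.FormallyUnramified.iff_comp_injective]
  intro B _ _ I hI f g hfg
  apply QuadraticAlgebra.algHom_ext
  have hsq : ∀ k : SqrtAlg d →ₐ[R] B, k omega * k omega = algebraMap R B d := fun k => by
    rw [← map_mul, omega_mul_omega_eq_mk, ← k.commutes]; rfl
  have hmem : f omega - g omega ∈ I := Ideal.Quotient.eq.mp (DFunLike.congr_fun hfg omega)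
  have hzero : (f omega - g omega) * (f omega - g omega) = 0 := by
    have := Ideal.mul_mem_mul hmem hmem
    rwa [← pow_two, hI] at this
  have hu : IsUnit (algebraMap R B 2 * g omega) :=
    (h2.map (algebraMap R B)).mul (isUnit_of_mul_isUnit_left (hsq g ▸ hd.map (algebraMap R B)))
  rw [← sub_eq_zero, ← hu.mul_right_eq_zero, map_ofNat]
  linear_combination hsq f - hsq g - hzero

theorem etale_biquadAlg (h2 : (2 : K) ≠ 0) {d u v : K} (hd : d ≠ 0)
    (huv : u ^ 2 - d * v ^ 2 ≠ 0) : Algebra.Etale K (BiquadAlg d u v) := by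
  have h2' : IsUnit (2 : SqrtAlg d) := by
    have := h2.isUnit.map (algebraMap K (SqrtAlg d))
    rwa [map_ofNat] at this
  have huv' : IsUnit (⟨u, v⟩ : SqrtAlg d) := by
    rw [isUnit_iff_norm_isUnit, isUnit_iff_ne_zero, norm_def]
    convert huv using 1
    simp only
    ring
  have := formallyUnramified_sqrtAlg h2.isUnit hd.isUnit
  have := formallyUnramified_sqrtAlg h2' huv'
  have : Algebra.FormallyUnramified K (BiquadAlg d u v) :=
    Algebra.FormallyUnramified.comp K (SqrtAlg d) _
  have : Module.Finite K (BiquadAlg d u v) := Module.Finite.trans (SqrtAlg d) _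
  have : Algebra.FormallyEtale K (BiquadAlg d u v) :=
    Algebra.FormallyEtale.iff_formallyUnramified_of_field.2 inferInstance
  have : Algebra.FinitePresentation K (BiquadAlg d u v) :=
    Algebra.FinitePresentation.of_finiteType.1 inferInstance
  exact ⟨inferInstance, inferInstance⟩

theorem biquadCoord_omega_sq {d u : K} (f : Coord K (BiquadAlg d u 1)) :
    f omega ^ 2 = algebraMap K _ u + f (algebraMap (SqrtAlg d) _ omega) := by
  rw [← map_pow, ← f.commutes, ← map_add]
  congr 1
  ext <;> simp [pow_two, IsScalarTower.algebraMap_apply K (SqrtAlg d) (BiquadAlg d u 1)]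

theorem biquadCoord_root {d u : K} (f : Coord K (BiquadAlg d u 1)) :
    (f omega ^ 2 - algebraMap K _ u) ^ 2 = algebraMap K _ d := by
  rw [biquadCoord_omega_sq, add_sub_cancel_left, ← map_pow, ← f.commutes]
  congr 1
  ext <;> simp [pow_two, IsScalarTower.algebraMap_apply K (SqrtAlg d) (BiquadAlg d u 1)]

theorem biquadCoord_algebraMap {d u : K} (f : Coord K (BiquadAlg d u 1)) (z : SqrtAlg d) :
    f (algebraMap (SqrtAlg d) _ z) =
      algebraMap K _ z.re + algebraMap K _ z.im * (f omega ^ 2 - algebraMap K _ u) := by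
  have := coord_apply (f.comp (IsScalarTower.toAlgHom K (SqrtAlg d) (BiquadAlg d u 1))) z
  simp only [AlgHom.comp_apply, IsScalarTower.coe_toAlgHom'] at this
  rw [this, biquadCoord_omega_sq, add_sub_cancel_left]

theorem biquadCoord_ext {d u : K} {f f' : Coord K (BiquadAlg d u 1)} (h : f omega = f' omega) :
    f = f' := by
  ext z
  have hz : z = algebraMap _ _ z.re + algebraMap _ _ z.im * omega := by
    rw [← Algebra.smul_def]
    exact mk_eq_add_smul_omega z.re z.im
  rw [hz, map_add, map_add, map_mul, map_mul,
    biquadCoord_algebraMap, biquadCoord_algebraMap, biquadCoord_algebraMap, biquadCoord_algebraMap,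
    h]

theorem exists_biquadCoord {d u : K} {r : SeparableClosure K}
    (hr : (r ^ 2 - algebraMap K _ u) ^ 2 = algebraMap K _ d) :
    ∃ f : Coord K (BiquadAlg d u 1), f omega = r := by
  obtain ⟨k, hk⟩ := exists_coord_omega_eq hr
  let := k.toRingHom.toAlgebra
  have : IsScalarTower K (SqrtAlg d) (SeparableClosure K) :=
    IsScalarTower.of_algebraMap_eq fun x => (k.commutes x).symm
  refine ⟨(QuadraticAlgebra.lift (R := SqrtAlg d) (A := SeparableClosure K) ⟨r, ?_⟩).restrictScalars
    K, ?_⟩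
  · rw [Algebra.smul_def, zero_smul, mul_one, add_zero]
    change _ = k _
    rw [coord_apply, hk, map_one]
    ring
  · simp [QuadraticAlgebra.lift]

theorem Represents.correspondsTo (h2 : (2 : SeparableClosure K) ≠ 0) (hD : D ≠ 0)
    (hi : i ^ 2 = -1) {σ : AbsGal K → CyclicFour D} {a b c : K} {β : SeparableClosure K}
    (hβ : β ≠ 0) (hc : norm (⟨a, b⟩ : SqrtAlg (-D)) = c ^ 4) (hb : b ≠ 0)
    (H : Represents i e σ ⟨a, b⟩ c β) : CorrespondsTo D σ (2 * a + 2 * c ^ 2) (2 * c) 1 := by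
  have h2K : (2 : K) ≠ 0 := by
    rintro h
    apply h2
    rw [← map_ofNat (algebraMap K (SeparableClosure K)) 2, h, map_zero]
  have hab : a ^ 2 + D * b ^ 2 = c ^ 4 := by
    rw [← hc, norm_def]
    ring
  have hDb : D * b ^ 2 ≠ 0 := mul_ne_zero hD (pow_ne_zero 2 hb)
  -- From `(c^2 - a)(c^2 + a) = D b^2 ≠ 0`, both factors are nonzero. They control `d` and the norm
  -- of `u + √d`.
  have hplus : a + c ^ 2 ≠ 0 := fun h => hDb (by linear_combination hab - (a - c ^ 2) * h)
  have hminus : c ^ 2 - a ≠ 0 := fun h => hDb (by linear_combination hab + (a + c ^ 2) * h)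
  have hd : 2 * a + 2 * c ^ 2 ≠ 0 := by
    rw [← mul_add]; exact mul_ne_zero h2K hplus
  have hu : (2 * c) ^ 2 - (2 * a + 2 * c ^ 2) * 1 ^ 2 ≠ 0 := by
    rw [show (2 * c) ^ 2 - (2 * a + 2 * c ^ 2) * 1 ^ 2 = 2 * (c ^ 2 - a) by ring]
    exact mul_ne_zero h2K hminus
  refine ⟨etale_biquadAlg h2K hd hu, ?_⟩
  obtain ⟨γ, hγ⟩ : ∃ γ, β * γ = algebraMap K _ c := ⟨algebraMap K _ c / β, mul_div_cancel₀ _ hβ⟩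
  have hw : (β ^ 2 + γ ^ 2) ^ 2 = algebraMap K _ (2 * a + 2 * c ^ 2) := by
    have h1 := H.pow_four
    have h3 := coord_mul_coord_star e ⟨a, b⟩
    rw [← h1, hc, map_pow, ← hγ, mul_pow] at h3
    have h4 := mul_left_cancel₀ (pow_ne_zero 4 hβ) h3
    rw [coord_apply] at h1
    rw [coord_star] at h4
    simp only [map_add, map_mul, map_pow, map_ofNat] at h1 h4 ⊢
    rw [← hγ]
    linear_combination h1 - h4
  have hw0 : β ^ 2 + γ ^ 2 ≠ 0 := by
    intro h
    rw [h, zero_pow two_ne_zero] at hw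
    exact hd ((algebraMap K (SeparableClosure K)).injective (by rw [← hw, map_zero]))
  -- The candidate images of the outer square root under the four coordinates.
  set r : CyclicFour D → SeparableClosure K := fun x => rootPow i x * β + rootPow i (-x) * γ with hr
  have r_sq : ∀ x, r x ^ 2 - algebraMap K _ (2 * c) = rootPow i (x + x) * (β ^ 2 + γ ^ 2) := by
    intro x
    have h1 : rootPow i (-x) ^ 2 = rootPow i x ^ 2 := by
      have h3 := rootPow_pow_four hi x
      have h4 := rootPow_mul_rootPow_neg hi x
      linear_combination -rootPow i (-x) ^ 2 * h3 +
        rootPow i x ^ 2 * (rootPow i x * rootPow i (-x) + 1) * h4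
    rw [rootPow_add hi, map_mul, map_ofNat, ← hγ]
    linear_combination γ ^ 2 * h1 + 2 * β * γ * rootPow_mul_rootPow_neg hi x
  have rootPow_sq : ∀ x : CyclicFour D, rootPow i (x + x) ^ 2 = 1 := fun x => by
    rw [rootPow_add hi, ← rootPow_pow_four hi x]; ring
  have r_root : ∀ x, (r x ^ 2 - algebraMap K _ (2 * c)) ^ 2 =
      algebraMap K _ (2 * a + 2 * c ^ 2) := fun x => by
    rw [r_sq, mul_pow, rootPow_sq, one_mul, hw]
  have r_add_two : ∀ x, r (x + ofZMod 2) = -r x := fun x => by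
    have : -(x + ofZMod 2) =
        -x + ofZMod 2 :=
      (by decide : ∀ x : ZMod 4, -(x + 2) = -x + 2) x
    simp only [hr, this, rootPow_add hi, rootPow_two hi]
    ring
  have r_ne_zero : ∀ x, r x ≠ 0 := fun x h => by
    have h1 := r_root x
    rw [h, zero_pow two_ne_zero, zero_sub, neg_sq, ← map_pow] at h1
    exact hu (by linear_combination (algebraMap K (SeparableClosure K)).injective h1)
  have sq_iff : ∀ x y, r x ^ 2 = r y ^ 2 ↔ 2 • x = 2 • y := fun x y => by
    have h := mul_left_inj' (a := rootPow i (x + x)) (b := rootPow i (y + y)) hw0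
    rw [← r_sq, ← r_sq, sub_left_inj, (rootPow_injective h2 hi).eq_iff] at h
    rw [h, two_nsmul, two_nsmul]
  have r_inj : Function.Injective r := fun x y hxy => by
    rcases two_smul_eq_iff.1 ((sq_iff x y).1 (by rw [hxy])) with h | h
    · exact h
    · rw [h, r_add_two] at hxy
      exact absurd hxy.symm (ne_neg_of_sq h2 (r_ne_zero y))
  have r_surj : ∀ s, (s ^ 2 - algebraMap K _ (2 * c)) ^ 2 = algebraMap K _ (2 * a + 2 * c ^ 2) →
      ∃ x, r x = s := by
    intro s hs
    -- The two signs of `β^2 + γ^2` occur at `x = 0` and `x = 1`; adding `2` to `x` then changes the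
    -- sign of `r x`.
    have h1 : ∃ x, s ^ 2 = r x ^ 2 := by
      rcases sq_eq_sq_iff_eq_or_eq_neg.1 (hs.trans hw.symm) with h | h
      · refine ⟨0, sub_left_inj.1 (h.trans ?_)⟩
        rw [r_sq, add_zero, rootPow_zero, one_mul]
      · refine ⟨ofZMod 1, sub_left_inj.1 (h.trans ?_)⟩
        rw [r_sq, rootPow_add hi, rootPow_one, ← pow_two, hi, neg_one_mul]
    obtain ⟨x, hx⟩ := h1
    rcases sq_eq_sq_iff_eq_or_eq_neg.1 hx with h | h
    · exact ⟨x, h.symm⟩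
    · exact ⟨_, (r_add_two x).trans h.symm⟩
  have r_gal : ∀ (g : AbsGal K) x, g (r x) = r (g • x + σ g) := by
    intro g x
    have hgγ : g β * g γ = β * γ := by rw [← map_mul, hγ, AlgEquiv.commutes]
    have hgβ : g β ≠ 0 := (map_ne_zero g).2 hβ
    simp only [hr, map_add, map_mul, neg_add, rootPow_add hi]
    have h1 := rootPow_mul_rootPow_neg hi (σ g)
    rcases map_eq_or_eq_neg (coord_omega_sq _ e) g with hg | hg
    · have hfix := H.fixed g hg
      have hγ' : g γ = rootPow i (-σ g) * γ := by
        apply mul_left_cancel₀ hgβ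
        rw [hgγ, hfix]
        linear_combination -β * γ * h1
      rw [hfix, hγ', map_rootPow_of_fixed h2 hD hi hg, map_rootPow_of_fixed h2 hD hi hg, smul_neg]
      ring
    · have hs := H.swapped g hg
      have hγ' : g γ = rootPow i (σ g) * β := by
        apply mul_left_cancel₀ hgβ
        rw [hgγ, hγ, hs]
      have hβ' : g β = rootPow i (-σ g) * γ := by
        apply mul_right_cancel₀ (mul_ne_zero (rootPow_ne_zero hi (σ g)) hβ)
        rw [hs, ← hγ]
        linear_combination -β * γ * h1
      rw [hβ', hγ', map_rootPow_of_swapped h2 hD hi hg, map_rootPow_of_swapped h2 hD hi hg,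
        smul_neg, neg_neg]
      ring
  choose ι hι using fun x => exists_biquadCoord (r_root x)
  have ι_bij : Function.Bijective ι := by
    refine ⟨fun x y hxy => r_inj (by rw [← hι, hxy, hι]), fun f => ?_⟩
    obtain ⟨x, hx⟩ := r_surj _ (biquadCoord_root f)
    exact ⟨x, biquadCoord_ext (by rw [hι, hx])⟩
  refine ⟨Equiv.ofBijective ι ι_bij, fun g x z => ?_, fun x y => ?_⟩
  · have : (g : SeparableClosure K →ₐ[K] SeparableClosure K).comp (ι x) = ι (g • x + σ g) := by
      apply biquadCoord_ext
      rw [hι, ← r_gal, ← hι]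
      rfl
    exact DFunLike.congr_fun this z
  · simp only [Equiv.ofBijective_apply, biquadCoord_algebraMap, hι]
    rw [← sq_iff]
    refine ⟨fun h z => by rw [h], fun h => ?_⟩
    simpa using h omega

end

/-! ### The Kummer isomorphism and representatives with `b ≠ 0` -/

section
open QuadraticAlgebra CyclicFour
variable {K : Type*} [Field K] {D : K}
variable {i : SeparableClosure K} {e : Coord K (SqrtAlg (-D))}

theorem norm_eq_of_mem_kummerData (p : kummerData D) :
    norm (p.1.1 : SqrtAlg (-D)) = (p.1.2 : K) ^ 4 := by
  have h : Units.map QuadraticAlgebra.norm p.1.1 = p.1.2 ^ 4 := p.2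
  simpa using congrArg Units.val h

theorem mem_kummerTrivial_iff (p : kummerData D) :
    p ∈ (kummerTrivial D).subgroupOf (kummerData D) ↔
      ∃ z : SqrtAlg (-D), z ^ 4 = p.1.1 ∧ norm z = (p.1.2 : K) := by
  rw [Subgroup.mem_subgroupOf]
  constructor
  · rintro ⟨z, hz⟩
    exact ⟨z, congrArg (fun q => (q.1 : SqrtAlg (-D))) hz, congrArg (fun q => (q.2 : K)) hz⟩
  · rintro ⟨z, hz, hz'⟩
    have hu : IsUnit z := by
      rw [isUnit_iff_norm_isUnit, hz']
      exact p.1.2.isUnit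
    obtain ⟨z, rfl⟩ := hu
    exact ⟨z, Prod.ext (Units.ext hz) (Units.ext hz')⟩

/-- The equivalence, valid for every cocycle in the class, is what later gives the kernel,
surjectivity and the quartic algebra. -/
theorem exists_cohomology_hom (h2 : (2 : SeparableClosure K) ≠ 0) (hD : D ≠ 0) (hi : i ^ 2 = -1)
    (e : Coord K (SqrtAlg (-D))) :
    ∃ f : kummerData D →* Multiplicative (H1 (AbsGal K) (CyclicFour D)),
      ∀ (p : kummerData D) (σ : Z1 (AbsGal K) (CyclicFour D)),
        f p = Multiplicative.ofAdd (QuotientAddGroup.mk σ) ↔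
          ∃ β, β ≠ 0 ∧ Represents i e σ p.1.1 p.1.2 β := by
  have ex : ∀ p : kummerData D, ∃ σ : Z1 (AbsGal K) (CyclicFour D), ∃ β, β ≠ 0 ∧
      Represents i e σ p.1.1 p.1.2 β := fun p =>
    Represents.exists_of_data h2 hD hi p.1.2.ne_zero (norm_eq_of_mem_kummerData p)
  choose s β hβ hs using ex
  have key : ∀ (p : kummerData D) (σ : Z1 (AbsGal K) (CyclicFour D)),
      (QuotientAddGroup.mk (s p) : H1 (AbsGal K) (CyclicFour D)) = QuotientAddGroup.mk σ ↔
        ∃ β, β ≠ 0 ∧ Represents i e σ p.1.1 p.1.2 β := by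
    intro p σ
    rw [QuotientAddGroup.eq, AddSubgroup.mem_addSubgroupOf]
    constructor
    · rintro ⟨x, hx⟩
      refine ⟨_, mul_ne_zero (rootPow_ne_zero hi x) (hβ p),
        (hs p).add_coboundary h2 hD hi x fun g => ?_⟩
      rw [← hx g]
      simp
    · rintro ⟨β', -, h⟩
      obtain ⟨x, hx⟩ := (hs p).sub_eq_coboundary h2 hD hi (hβ p) h
      refine ⟨x, fun g => ?_⟩
      simp [hx g]
  refine ⟨MonoidHom.mk' (fun p => Multiplicative.ofAdd (QuotientAddGroup.mk (s p))) ?_,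
    fun p σ => ?_⟩
  · intro p q
    rw [← ofAdd_add, ← QuotientAddGroup.mk_add]
    refine congrArg _ ((key (p * q) _).2 ⟨_, mul_ne_zero (hβ p) (hβ q), ?_⟩)
    exact (hs p).mul hi (hs q)
  · exact (Multiplicative.ofAdd.apply_eq_iff_eq).trans (key p σ)

theorem exists_im_ne_zero (h2 : (2 : K) ≠ 0) (hcard : 5 < ENat.card K)
    (q : KummerGroup D) :
    ∃ p : kummerData D, QuotientGroup.mk p = q ∧ (p.1.1 : SqrtAlg (-D)).im ≠ 0 := by
  classical
  induction q using QuotientGroup.induction_on with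
  | H p =>
  by_cases him : (p.1.1 : SqrtAlg (-D)).im = 0
  swap
  · exact ⟨p, rfl, him⟩
  -- If `b = 0`, multiply by the trivial pair of `x + √(-D)`. Its fourth power has
  -- `√(-D)`-coefficient `4x(x^2 - D)` and its norm is `x^2 + D`, so at most `1 + 2 + 2 = 5` values
  -- of `x` are excluded.
  obtain ⟨x, hx0, hx1, hx2⟩ : ∃ x : K, x ≠ 0 ∧ x ^ 2 ≠ D ∧ x ^ 2 ≠ -D := by
    by_contra! H
    let t : Multiset K := 0 ::ₘ (Polynomial.nthRoots 2 D + Polynomial.nthRoots 2 (-D))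
    have ht : ∀ x : K, x ∈ t.toFinset := by
      intro x
      simp only [t, Multiset.mem_toFinset, Multiset.mem_cons, Multiset.mem_add,
        Polynomial.mem_nthRoots two_pos]
      by_cases h0 : x = 0
      · exact Or.inl h0
      by_cases h1 : x ^ 2 = D
      · exact Or.inr (Or.inl h1)
      · exact Or.inr (Or.inr (H x h0 h1))
    have hf : Fintype K := ⟨t.toFinset, ht⟩
    rw [ENat.card_eq_coe_fintype_card] at hcard
    have h5 : Fintype.card K ≤ 5 := by
      calc Fintype.card K ≤ t.toFinset.card := Finset.card_le_card fun x _ => ht x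
        _ ≤ t.card := Multiset.toFinset_card_le t
        _ ≤ 5 := by
          have := Polynomial.card_nthRoots 2 D
          have := Polynomial.card_nthRoots 2 (-D)
          simp only [t, Multiset.card_cons, Multiset.card_add]
          omega
    exact absurd hcard (not_lt.2 (by exact_mod_cast h5))
  have hN : norm (⟨x, 1⟩ : SqrtAlg (-D)) = x ^ 2 + D := by rw [norm_def]; ring
  have hz : IsUnit (⟨x, 1⟩ : SqrtAlg (-D)) := by
    rw [isUnit_iff_norm_isUnit, hN, isUnit_iff_ne_zero]
    exact fun h => hx2 (by linear_combination h)
  obtain ⟨z, hz⟩ := hz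
  have hre : (p.1.1 : SqrtAlg (-D)).re ≠ 0 := fun h =>
    p.1.1.ne_zero (QuadraticAlgebra.ext h him)
  have hmem : ((z ^ 4, Units.map QuadraticAlgebra.norm z) : (SqrtAlg (-D))ˣ × Kˣ) ∈
      kummerData D := map_pow (Units.map QuadraticAlgebra.norm) z 4
  refine ⟨p * ⟨_, hmem⟩, ?_, ?_⟩
  · rw [eq_comm, QuotientGroup.eq, inv_mul_cancel_left, Subgroup.mem_subgroupOf]
    exact ⟨z, rfl⟩
  · have h4 : ((⟨x, 1⟩ : SqrtAlg (-D)) ^ 4).im = 4 * x * (x ^ 2 - D) := by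
      rw [show (4 : ℕ) = 2 * 2 from rfl, pow_mul, pow_two, pow_two]
      simp only [im_mul, re_mul]
      ring
    change ((p.1.1 : SqrtAlg (-D)) * (z : SqrtAlg (-D)) ^ 4).im ≠ 0
    rw [hz, im_mul, him, h4]
    simp only [zero_mul, mul_zero, add_zero]
    refine mul_ne_zero hre (mul_ne_zero (mul_ne_zero ?_ hx0) (sub_ne_zero.2 hx1))
    rw [show (4 : K) = 2 * 2 by norm_num]
    exact mul_ne_zero h2 h2

end

theorem mainTheorem3 {K : Type*} [Field K] (hK : ringChar K ≠ 2) (D : K) (hD : D ≠ 0) :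
    (∃ Φ : H1 (AbsGal K) (CyclicFour D) ≃+ Additive (KummerGroup D),
      ∀ (σ : Z1 (AbsGal K) (CyclicFour D)) (p : kummerData D) (a b c : K),
        (p.1.1 : SqrtAlg (-D)) = ⟨a, b⟩ → (p.1.2 : K) = c → b ≠ 0 →
        Φ (QuotientAddGroup.mk σ) = Additive.ofMul (QuotientGroup.mk p) →
        CorrespondsTo D σ (2 * a + 2 * c ^ 2) (2 * c) 1) ∧
    (5 < ENat.card K → ∀ q : KummerGroup D, ∃ p : kummerData D,
      QuotientGroup.mk p = q ∧ (p.1.1 : SqrtAlg (-D)).im ≠ 0) := by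
  have h2K : (2 : K) ≠ 0 := Ring.two_ne_zero hK
  refine ⟨?_, exists_im_ne_zero h2K⟩
  have h2 : (2 : SeparableClosure K) ≠ 0 := by
    have := (map_ne_zero (algebraMap K (SeparableClosure K))).2 h2K
    rwa [map_ofNat] at this
  have : NeZero ((2 : ℕ) : SeparableClosure K) := ⟨h2⟩
  obtain ⟨i, hi⟩ := IsSepClosed.exists_pow_nat_eq (-1 : SeparableClosure K) 2
  obtain ⟨e⟩ := exists_coord h2 (-D)
  obtain ⟨f, hf⟩ := exists_cohomology_hom h2 hD hi e
  have hsurj : Function.Surjective f := by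
    intro y
    obtain ⟨σ, hσ⟩ := QuotientAddGroup.mk_surjective (Multiplicative.toAdd y)
    obtain ⟨α, c, β, hc0, hc, hβ, H⟩ := Represents.exists_of_cocycle (e := e) h2 hD hi σ
    have hα : IsUnit α := by
      rw [QuadraticAlgebra.isUnit_iff_norm_isUnit, hc]
      exact (pow_ne_zero 4 hc0).isUnit
    refine ⟨⟨(hα.unit, Units.mk0 c hc0), Units.ext hc⟩, ?_⟩
    rw [(hf _ σ).2 ⟨β, hβ, H⟩, hσ]
    rfl
  have hker : f.ker = (kummerTrivial D).subgroupOf (kummerData D) := by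
    ext p
    rw [MonoidHom.mem_ker, mem_kummerTrivial_iff]
    -- A pair lies in the kernel exactly when it is represented by the zero cocycle, and such a
    -- representation is a descent to a pair `(z^4, N z)`.
    refine (hf p 0).trans ⟨?_, ?_⟩
    · rintro ⟨β, hβ, H⟩
      exact Represents.eq_of_zero h2 hD hβ (norm_eq_of_mem_kummerData p) H
    · rintro ⟨z, hz, hz'⟩
      refine ⟨e z, ?_, ?_⟩
      · intro h
        have := coord_mul_coord_star e z
        rw [h, zero_mul, hz'] at this
        exact (map_ne_zero (algebraMap K (SeparableClosure K))).2 p.1.2.ne_zero this.symm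
      · rw [← hz, ← hz']
        exact Represents.of_trivial z
  let Ψ : KummerGroup D ≃* Multiplicative (H1 (AbsGal K) (CyclicFour D)) :=
    (QuotientGroup.quotientMulEquivOfEq hker.symm).trans
      (QuotientGroup.quotientKerEquivOfSurjective f hsurj)
  refine ⟨(MulEquiv.toAdditiveLeft Ψ).symm, fun σ p a b c hp hc hb h => ?_⟩
  have h' : f p = Multiplicative.ofAdd (QuotientAddGroup.mk σ) := by
    rw [AddEquiv.symm_apply_eq] at h
    exact h.symm
  obtain ⟨β, hβ, H⟩ := (hf p σ).1 h'
  have hn := norm_eq_of_mem_kummerData p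
  rw [hp, hc] at H hn
  exact H.correspondsTo h2 hD hi hβ hn hb
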